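/- Let $G=(V,E)$ be a finite simple undirected graph. For each $v\in V$ let $X_v$ be a random variable with values in a standard Borel space $\mathcal X_v$, and let $P$ be the joint distribution of $X=(X_v)_{v\in V}$ on $\prod_{v\in V}\mathcal X_v$. Assume that $P$ is strictly positive, i.e. that it has an everywhere strictly positive density with respect to some product $\bigotimes_{v\in V}\mu_v$ of $\sigma$-finite measures $\mu_v$ on $\mathcal X_v$ (for instance, counting measures for discrete variables or Lebesgue measures for continuous ones). For $S\subseteq V$ write $X_S=(X_v)_{v\in S}$. Consider the following properties of $P$. (MCIP) For every maximal (with respect to inclusion) independent set $C\subseteq V$ of $G$, the variables $X_v$, $v\in C$, are mutually conditionally independent given $X_{V\setminus C}$. (P) Pairwise Markov property: for all distinct non-adjacent $v,w\in V$, $X_v\perp\!\!\!\perp X_w\mid X_{V\setminus\{v,w\}}$. (L) Local Markov property: for every $v\in V$, $X_v\perp\!\!\!\perp X_{V\setminus(\{v\}\cup \mathrm{bd}(v))}\mid X_{\mathrm{bd}(v)}$, where $\mathrm{bd}(v)$ is the set of neighbours of $v$. (G) Global Markov property: for all pairwise disjoint $A,B,C\subseteq V$ such that $C$ separates $A$ from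 $B$ in $G$ (every path from a vertex of $A$ to a vertex of $B$ meets $C$), $X_A\perp\!\!\!\perp X_B\mid X_C$. If $P$ satisfies (MCIP), then $P$ satisfies (P), (L) and (G). Moreover the four properties are equivalent: (MCIP) $\iff$ (P) $\iff$ (L) $\iff$ (G). -/

import Mathlib

open MeasureTheory ProbabilityTheory

namespace MarkovNetwork

variable {V : Type*} {X : V → Type*} [∀ v, MeasurableSpace (X v)]

/-- The σ-algebra on the joint state space `∏ v, X v` generated by the variables `x_v`, `v ∈ S`. -/
@[reducible] def coordSigma (X : V → Type*) [∀ v, MeasurableSpace (X v)] (S : Set V) :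
    MeasurableSpace (∀ v, X v) :=
  MeasurableSpace.comap (S.domRestrict : (∀ v, X v) → ∀ v : S, X v) inferInstance

theorem coordSigma_le (S : Set V) : coordSigma X S ≤ MeasurableSpace.pi :=
  (Set.measurable_restrict S).comap_le

/-- `P` is a strictly positive distribution: it has an everywhere positive density with respect
to some product of σ-finite measures (counting measures for discrete variables, Lebesgue measures
for continuous ones, or a mixture of both). -/
def IsStrictlyPositive [Fintype V] (P : Measure (∀ v, X v)) : Prop :=
  ∃ μ : ∀ v, Measure (X v), (∀ v, SigmaFinite (μ v)) ∧
    ∃ p : (∀ v, X v) → ℝ, Measurable p ∧ (∀ x, 0 < p x) ∧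
      P = (Measure.pi μ).withDensity (fun x => ENNReal.ofReal (p x))

/-- `C` separates `A` from `B` in `G`: every walk from `A` to `B` meets `C`. -/
def Separates (G : SimpleGraph V) (A B C : Set V) : Prop :=
  ∀ a ∈ A, ∀ b ∈ B, ∀ w : G.Walk a b, ∃ c ∈ C, c ∈ w.support

variable [Finite V] [∀ v, StandardBorelSpace (X v)]

/-- `X_A ⫫ X_B ∣ X_C` under the joint distribution `P`. -/
def CondIndepGiven (P : Measure (∀ v, X v)) [IsProbabilityMeasure P] (A B C : Set V) : Prop :=
  CondIndepFun (coordSigma X C) (coordSigma_le C)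
    (A.domRestrict : (∀ v, X v) → ∀ v : A, X v) (B.domRestrict : (∀ v, X v) → ∀ v : B, X v) P

/-- The variables `x_v`, `v ∈ S`, are mutually conditionally independent given the variables
indexed by `C`, under the joint distribution `P`. -/
def MutualCondIndepGiven (P : Measure (∀ v, X v)) [IsProbabilityMeasure P] (S C : Set V) : Prop :=
  iCondIndepFun (coordSigma X C) (coordSigma_le C)
    (fun (v : S) (x : ∀ v, X v) => x (v : V)) P

/-- The mutual conditional independence property: the variables in any maximal independent set `S`
are mutually conditionally independent given the variables outside `S`. -/
def MCIP (G : SimpleGraph V) (P : Measure (∀ v, X v)) [IsProbabilityMeasure P] : Prop :=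
  ∀ S : Set V, Maximal G.IsIndepSet S → MutualCondIndepGiven P S Sᶜ

/-- Pairwise Markov property. -/
def PairwiseMarkov (G : SimpleGraph V) (P : Measure (∀ v, X v)) [IsProbabilityMeasure P] : Prop :=
  ∀ v w : V, v ≠ w → ¬ G.Adj v w → CondIndepGiven P {v} {w} ({v, w}ᶜ)

/-- Local Markov property; the boundary of `v` is its set of neighbours. -/
def LocalMarkov (G : SimpleGraph V) (P : Measure (∀ v, X v)) [IsProbabilityMeasure P] : Prop :=
  ∀ v : V, CondIndepGiven P {v} (({v} ∪ G.neighborSet v)ᶜ) (G.neighborSet v)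

/-- Global Markov property. -/
def GlobalMarkov (G : SimpleGraph V) (P : Measure (∀ v, X v)) [IsProbabilityMeasure P] : Prop :=
  ∀ A B C : Set V, Disjoint A B → Disjoint A C → Disjoint B C → Separates G A B C →
    CondIndepGiven P A B C

end MarkovNetwork

/-!
The heart of the matter is that, for a strictly positive `P`, the pairwise Markov property upgrades
from pairs of vertices to pairs of sets: if no edge joins the disjoint sets `A` and `B`, then
`X_A` and `X_B` are conditionally independent given all the other variables
(`PairwiseMarkov.condIndepGiven_compl`). This follows by adding one vertex at a time from the
intersection property `CondIndepGiven.union_right`, stated only for conditioning on all the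
remaining variables, so that no marginal density of `P` is ever needed.

The intersection property itself uses positivity through the following fact
(`IsStrictlyPositive.exists_measurable_inter`). If a function of the coordinates in `S` agrees
`P`-almost everywhere with a function of the coordinates in `T`, then it agrees almost everywhere
with a function of the coordinates in `S ∩ T`. Indeed `P` has the same null sets as a product
measure, so by Fubini the coordinates outside `S` can be frozen at suitable values. The fact is
applied to conditional probabilities, conditional independence being restated as the invariance of
conditional probabilities under additional conditioning (`condIndep_iff_condExp_sup_eq`).

Granted the set version, the global Markov property comes from splitting the complement of `C` into
the vertices reachable from `A` off `C` and the rest; and mutual conditional independence inside an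
independent set `S` comes from the independence of each `X_v`, `v ∈ S`, from the variables in
`S \ {v}` given those outside `S`. The implications from the global to the local property, from
the local to the pairwise one, and from mutual conditional independence to the pairwise property
hold without positivity, by weak union.
-/

/-! ### Conditional independence and conditional expectations -/

namespace MeasureTheory

theorem isPiSystem_inter_measurableSet {Ω : Type*} (m₁ m₂ : MeasurableSpace Ω) :
    IsPiSystem {s : Set Ω | ∃ a b, MeasurableSet[m₁] a ∧ MeasurableSet[m₂] b ∧ s = a ∩ b} := by
  rintro _ ⟨a, b, ha, hb, rfl⟩ _ ⟨c, d, hc, hd, rfl⟩ -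
  exact ⟨a ∩ c, b ∩ d, ha.inter hc, hb.inter hd, Set.inter_inter_inter_comm a b c d⟩

theorem sup_eq_generateFrom_inter_measurableSet {Ω : Type*} (m₁ m₂ : MeasurableSpace Ω) :
    m₁ ⊔ m₂ = MeasurableSpace.generateFrom
      {s : Set Ω | ∃ a b, MeasurableSet[m₁] a ∧ MeasurableSet[m₂] b ∧ s = a ∩ b} := by
  apply le_antisymm
  · refine sup_le (fun s hs => ?_) fun s hs => ?_
    · exact MeasurableSpace.measurableSet_generateFrom
        ⟨s, Set.univ, hs, MeasurableSet.univ, (Set.inter_univ s).symm⟩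
    · exact MeasurableSpace.measurableSet_generateFrom
        ⟨Set.univ, s, MeasurableSet.univ, hs, (Set.univ_inter s).symm⟩
  · refine MeasurableSpace.generateFrom_le ?_
    rintro _ ⟨a, b, ha, hb, rfl⟩
    exact MeasurableSet.inter (le_sup_left (a := m₁) (b := m₂) a ha)
      (le_sup_right (a := m₁) (b := m₂) b hb)

/-- Two integrable functions whose integrals agree on the intersections `a ∩ b` of an `m₁`-measurable
and an `m₂`-measurable set have equal integrals on every `m₁ ⊔ m₂`-measurable set. -/
theorem setIntegral_eq_of_forall_inter {Ω : Type*} {m₁ m₂ mΩ : MeasurableSpace Ω}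
    (hm₁ : m₁ ≤ mΩ) (hm₂ : m₂ ≤ mΩ) {μ : Measure Ω} {f g : Ω → ℝ}
    (hf : Integrable f μ) (hg : Integrable g μ)
    (h : ∀ a b, MeasurableSet[m₁] a → MeasurableSet[m₂] b →
      ∫ x in a ∩ b, f x ∂μ = ∫ x in a ∩ b, g x ∂μ)
    {s : Set Ω} (hs : MeasurableSet[m₁ ⊔ m₂] s) :
    ∫ x in s, f x ∂μ = ∫ x in s, g x ∂μ := by
  have hm : m₁ ⊔ m₂ ≤ mΩ := sup_le hm₁ hm₂
  have huniv : ∫ x, f x ∂μ = ∫ x, g x ∂μ := by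
    simpa using h Set.univ Set.univ MeasurableSet.univ MeasurableSet.univ
  induction s, hs using MeasurableSpace.induction_on_inter (m := m₁ ⊔ m₂)
    (sup_eq_generateFrom_inter_measurableSet m₁ m₂) (isPiSystem_inter_measurableSet m₁ m₂) with
  | empty => simp
  | basic t ht =>
    obtain ⟨a, b, ha, hb, rfl⟩ := ht
    exact h a b ha hb
  | compl t ht iht =>
    have hf' := integral_add_compl (hm t ht) hf
    have hg' := integral_add_compl (hm t ht) hg
    linarith
  | iUnion u hdisj hu ihu =>
    rw [integral_iUnion (fun i => hm _ (hu i)) hdisj hf.integrableOn,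
      integral_iUnion (fun i => hm _ (hu i)) hdisj hg.integrableOn]
    exact tsum_congr ihu

end MeasureTheory

namespace ProbabilityTheory

variable {Ω : Type*} {m' m₁ m₂ m₃ mΩ : MeasurableSpace Ω}

/-- `m₁` and `m₂` are conditionally independent given `m'` exactly when adjoining `m₂` to the
conditioning does not change the conditional probabilities of the events of `m₁`. -/
theorem condIndep_iff_condExp_sup_eq [StandardBorelSpace Ω] (hm' : m' ≤ mΩ) (hm₁ : m₁ ≤ mΩ)
    (hm₂ : m₂ ≤ mΩ) (μ : Measure Ω) [IsFiniteMeasure μ] :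
    CondIndep m' m₁ m₂ hm' μ ↔
      ∀ t, MeasurableSet[m₁] t → μ⟦t | m₂ ⊔ m'⟧ =ᵐ[μ] μ⟦t | m'⟧ := by
  have hint (t : Set Ω) (ht : MeasurableSet t) : Integrable (t.indicator fun _ => (1 : ℝ)) μ :=
    (integrable_const 1).indicator ht
  have hmul (t : Set Ω) (f : Ω → ℝ) : (t.indicator fun _ => (1 : ℝ)) * f = t.indicator f := by
    ext x
    by_cases hx : x ∈ t <;> simp [hx]
  rw [condIndep_iff _ _ _ hm' hm₁ hm₂]
  constructor
  · intro h t ht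
    have hsm : StronglyMeasurable[m₂ ⊔ m'] (μ⟦t | m'⟧) :=
      stronglyMeasurable_condExp.mono le_sup_right
    refine (ae_eq_condExp_of_forall_setIntegral_eq (sup_le hm₂ hm') (hint t (hm₁ t ht))
      (fun s _ _ => integrable_condExp.integrableOn) (fun s hs _ => ?_)
      hsm.aestronglyMeasurable).symm
    refine setIntegral_eq_of_forall_inter hm₂ hm' integrable_condExp (hint t (hm₁ t ht))
      (fun a b ha hb => ?_) hs
    have hpull : μ[a.indicator (μ⟦t | m'⟧) | m'] =ᵐ[μ] μ⟦a ∩ t | m'⟧ := by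
      have h1 := condExp_mul_of_stronglyMeasurable_right (μ := μ) (m := m')
        (f := a.indicator fun _ => (1 : ℝ)) (g := μ⟦t | m'⟧)
        stronglyMeasurable_condExp
        (by rw [hmul]; exact integrable_condExp.indicator (hm₂ a ha)) (hint a (hm₂ a ha))
      rw [hmul] at h1
      refine h1.trans ?_
      rw [Set.inter_comm a t]
      exact ((h t a ht ha).trans (Filter.EventuallyEq.of_eq (mul_comm _ _))).symm
    calc ∫ x in a ∩ b, (μ⟦t | m'⟧) x ∂μ
        = ∫ x in b, a.indicator (μ⟦t | m'⟧) x ∂μ := by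
          rw [setIntegral_indicator (hm₂ a ha), Set.inter_comm]
      _ = ∫ x in b, (μ[a.indicator (μ⟦t | m'⟧) | m']) x ∂μ :=
          (setIntegral_condExp hm' (integrable_condExp.indicator (hm₂ a ha)) hb).symm
      _ = ∫ x in b, (μ⟦a ∩ t | m'⟧) x ∂μ :=
          integral_congr_ae (ae_restrict_of_ae hpull)
      _ = ∫ x in b, (a ∩ t).indicator (fun _ => (1 : ℝ)) x ∂μ :=
          setIntegral_condExp hm' (hint _ ((hm₂ a ha).inter (hm₁ t ht))) hb
      _ = ∫ x in a ∩ b, t.indicator (fun _ => (1 : ℝ)) x ∂μ := by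
          rw [← Set.indicator_indicator, setIntegral_indicator (hm₂ a ha), Set.inter_comm]
  · intro h t a ht ha
    have hsup : m₂ ⊔ m' ≤ mΩ := sup_le hm₂ hm'
    have ha' : StronglyMeasurable[m₂ ⊔ m'] (a.indicator fun _ => (1 : ℝ)) :=
      stronglyMeasurable_const.indicator (le_sup_left (a := m₂) (b := m') a ha)
    have hta : (a.indicator fun _ => (1 : ℝ)) * (t.indicator fun _ => (1 : ℝ))
        = (t ∩ a).indicator fun _ => (1 : ℝ) := by
      rw [hmul, Set.indicator_indicator, Set.inter_comm]
    have h1 : μ⟦t ∩ a | m₂ ⊔ m'⟧ =ᵐ[μ] (a.indicator fun _ => (1 : ℝ)) * μ⟦t | m'⟧ := by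
      have := condExp_mul_of_stronglyMeasurable_left (μ := μ) ha'
        (by rw [hta]; exact hint _ ((hm₁ t ht).inter (hm₂ a ha))) (hint t (hm₁ t ht))
      rw [hta] at this
      exact this.trans (Filter.EventuallyEq.rfl.mul (h t ht))
    have h2 := condExp_mul_of_stronglyMeasurable_right (μ := μ) (m := m')
        (f := a.indicator fun _ => (1 : ℝ)) (g := μ⟦t | m'⟧)
        stronglyMeasurable_condExp
        (by rw [hmul]; exact integrable_condExp.indicator (hm₂ a ha)) (hint a (hm₂ a ha))
    calc μ⟦t ∩ a | m'⟧ =ᵐ[μ] μ[μ⟦t ∩ a | m₂ ⊔ m'⟧ | m'] :=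
          (condExp_condExp_of_le le_sup_right hsup).symm
      _ =ᵐ[μ] μ[(a.indicator fun _ => (1 : ℝ)) * μ⟦t | m'⟧ | m'] := condExp_congr_ae h1
      _ =ᵐ[μ] μ⟦a | m'⟧ * μ⟦t | m'⟧ := h2
      _ = μ⟦t | m'⟧ * μ⟦a | m'⟧ := mul_comm _ _

/-- The weak union property of conditional independence. -/
theorem CondIndep.weak_union [StandardBorelSpace Ω] {hm' : m' ≤ mΩ}
    (hm₁ : m₁ ≤ mΩ) (hm₂ : m₂ ≤ mΩ) (hm₃ : m₃ ≤ mΩ) {μ : Measure Ω} [IsFiniteMeasure μ]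
    (h : CondIndep m' m₁ (m₂ ⊔ m₃) hm' μ) :
    CondIndep (m₃ ⊔ m') m₁ m₂ (sup_le hm₃ hm') μ := by
  rw [condIndep_iff_condExp_sup_eq _ hm₁ (sup_le hm₂ hm₃)] at h
  rw [condIndep_iff_condExp_sup_eq _ hm₁ hm₂, ← sup_assoc]
  intro t ht
  refine (h t ht).trans ?_
  have hle : m₃ ⊔ m' ≤ m₂ ⊔ m₃ ⊔ m' := sup_le_sup_right le_sup_right m'
  calc μ⟦t | m'⟧ = μ[μ⟦t | m'⟧ | m₃ ⊔ m'] :=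
        (condExp_of_stronglyMeasurable (sup_le hm₃ hm')
          (stronglyMeasurable_condExp.mono le_sup_right) integrable_condExp).symm
    _ =ᵐ[μ] μ[μ⟦t | m₂ ⊔ m₃ ⊔ m'⟧ | m₃ ⊔ m'] := condExp_congr_ae (h t ht).symm
    _ =ᵐ[μ] μ⟦t | m₃ ⊔ m'⟧ := condExp_condExp_of_le hle (sup_le (sup_le hm₂ hm₃) hm')

end ProbabilityTheory

namespace MarkovNetwork

/-! ### The σ-algebras generated by sets of coordinates -/

section coordSigma

variable {V : Type*} {X : V → Type*} [∀ v, MeasurableSpace (X v)]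

theorem coordSigma_eq_iSup (S : Set V) :
    coordSigma X S = ⨆ v ∈ S, MeasurableSpace.comap (fun x : ∀ v, X v => x v) inferInstance := by
  rw [iSup_subtype', coordSigma, MeasurableSpace.pi, MeasurableSpace.comap_iSup]
  refine iSup_congr fun v => ?_
  rw [MeasurableSpace.comap_comp]
  rfl

theorem coordSigma_union (S T : Set V) :
    coordSigma X (S ∪ T) = coordSigma X S ⊔ coordSigma X T := by
  simp_rw [coordSigma_eq_iSup, iSup_union]

theorem coordSigma_mono {S T : Set V} (h : S ⊆ T) : coordSigma X S ≤ coordSigma X T := by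
  simp_rw [coordSigma_eq_iSup]
  exact biSup_mono h

theorem coordSigma_singleton (v : V) :
    coordSigma X {v} = MeasurableSpace.comap (fun x : ∀ v, X v => x v) inferInstance := by
  rw [coordSigma_eq_iSup, iSup_singleton]

/-- A real function measurable with respect to the coordinates in `S` depends only on these
coordinates. -/
theorem apply_eq_of_measurable_coordSigma {S : Set V} {f : (∀ v, X v) → ℝ}
    (hf : Measurable[coordSigma X S] f) {x y : ∀ v, X v} (hxy : ∀ v ∈ S, x v = y v) :
    f x = f y :=
  hf.factorsThrough (f := (S.domRestrict : (∀ v, X v) → ∀ v : S, X v))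
    (funext fun v => hxy v v.2)

/-- Freezing the coordinates in `B` at the values `y` removes them from the coordinates on which a
function depends. -/
theorem measurable_piecewise_coordSigma (B T : Set V) [∀ v, Decidable (v ∈ B)] (y : ∀ v, X v) :
    Measurable[coordSigma X (T \ B), coordSigma X T] fun x => B.piecewise y x := by
  rw [measurable_iff_comap_le]
  conv_lhs => rw [coordSigma_eq_iSup]
  simp_rw [MeasurableSpace.comap_iSup, iSup_le_iff, MeasurableSpace.comap_comp]
  intro v hv
  by_cases hvB : v ∈ B
  · have : ((fun x : ∀ v, X v => x v) ∘ fun x => B.piecewise y x) = fun _ => y v := by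
      ext x
      simp [hvB]
    rw [this, MeasurableSpace.comap_const]
    exact bot_le
  · have : ((fun x : ∀ v, X v => x v) ∘ fun x => B.piecewise y x) = fun x => x v := by
      ext x
      simp [hvB]
    rw [this, ← coordSigma_singleton]
    exact coordSigma_mono (by simpa using ⟨hv, hvB⟩)

end coordSigma

/-! ### Freezing coordinates under a product measure -/

section positivity

variable {V : Type*} [Fintype V] {X : V → Type*} [∀ v, MeasurableSpace (X v)]

/-- If a property holds almost everywhere for a nonzero product measure, then the coordinates in `B`
can be frozen at some values `y` so that it still holds for almost every choice of the others. -/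
theorem exists_ae_pi_piecewise (μ : ∀ v, Measure (X v)) [∀ v, SigmaFinite (μ v)]
    (hμ : Measure.pi μ ≠ 0) (B : Set V) [∀ v, Decidable (v ∈ B)] {p : (∀ v, X v) → Prop}
    (hp : ∀ᵐ x ∂Measure.pi μ, p x) :
    ∃ y : ∀ v, X v, ∀ᵐ x ∂Measure.pi μ, p (B.piecewise y x) := by
  have e := measurePreserving_piEquivPiSubtypeProd μ (fun v => v ∈ B)
  have hprod := (e.symm _).quasiMeasurePreserving.ae hp
  have hB : (Measure.pi fun v : {v // v ∈ B} => μ v) ≠ 0 := by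
    intro h0
    apply hμ
    have := e.symm.map_eq
    rw [h0, Measure.zero_prod, Measure.map_zero] at this
    exact this.symm
  have : (ae (Measure.pi fun v : {v // v ∈ B} => μ v)).NeBot := ae_neBot.2 hB
  obtain ⟨b, hb⟩ := (Measure.ae_ae_of_ae_prod hprod).exists
  have : (ae (Measure.pi μ)).NeBot := ae_neBot.2 hμ
  obtain ⟨x₀, -⟩ := hp.exists
  refine ⟨fun v => if h : v ∈ B then b ⟨v, h⟩ else x₀ v, ?_⟩
  have hsnd := (Measure.quasiMeasurePreserving_snd.comp e.quasiMeasurePreserving).ae hb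
  filter_upwards [hsnd] with x hx
  convert hx using 1
  ext v
  by_cases hv : v ∈ B <;> simp [hv, MeasurableEquiv.piEquivPiSubtypeProd,
    Equiv.piEquivPiSubtypeProd]

/-- Under a strictly positive distribution, a function of the coordinates in `S` which is almost
everywhere equal to a function of the coordinates in `T` is almost everywhere equal to a function
of the coordinates in `S ∩ T`. -/
theorem IsStrictlyPositive.exists_measurable_inter {P : Measure (∀ v, X v)} [IsProbabilityMeasure P]
    (hP : IsStrictlyPositive P) {S T : Set V} {f g : (∀ v, X v) → ℝ}
    (hf : Measurable[coordSigma X S] f) (hg : Measurable[coordSigma X T] g) (hfg : f =ᵐ[P] g) :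
    ∃ h : (∀ v, X v) → ℝ, Measurable[coordSigma X (S ∩ T)] h ∧ f =ᵐ[P] h := by
  classical
  obtain ⟨μ, hσ, p, hp, hpos, rfl⟩ := hP
  have hac : (Measure.pi μ).withDensity (fun x => ENNReal.ofReal (p x)) ≪ Measure.pi μ :=
    withDensity_absolutelyContinuous _ _
  have hac' : Measure.pi μ ≪ (Measure.pi μ).withDensity (fun x => ENNReal.ofReal (p x)) :=
    withDensity_absolutelyContinuous' hp.ennreal_ofReal.aemeasurable
      (ae_of_all _ fun x => (ENNReal.ofReal_pos.2 (hpos x)).ne')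
  have hμ : Measure.pi μ ≠ 0 := by
    intro h0
    have h1 : (Measure.pi μ).withDensity (fun x => ENNReal.ofReal (p x)) = 0 := by
      rw [h0, withDensity_zero_left]
    exact IsProbabilityMeasure.ne_zero _ h1
  obtain ⟨y, hy⟩ := exists_ae_pi_piecewise μ hμ Sᶜ (hac'.ae_le hfg)
  refine ⟨fun x => g (Sᶜ.piecewise y x), ?_, hac.ae_le ?_⟩
  · have := hg.comp (measurable_piecewise_coordSigma Sᶜ T y)
    rwa [Set.sdiff_compl, Set.inter_comm] at this
  · filter_upwards [hy] with x hx
    rw [← hx]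
    exact apply_eq_of_measurable_coordSigma hf fun v hv => by simp [hv]

end positivity

section condIndepGiven

variable {V : Type*} [Finite V] {X : V → Type*} [∀ v, MeasurableSpace (X v)]
  [∀ v, StandardBorelSpace (X v)] {P : Measure (∀ v, X v)} [IsProbabilityMeasure P]

/-! ### Graphoid properties -/

theorem condIndepGiven_iff_condIndep {A B C : Set V} :
    CondIndepGiven P A B C ↔
      CondIndep (coordSigma X C) (coordSigma X A) (coordSigma X B) (coordSigma_le C) P :=
  condIndepFun_iff_condIndep _ _ _ _ _

theorem condIndepGiven_iff_condExp_eq {A B C : Set V} :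
    CondIndepGiven P A B C ↔ ∀ t, MeasurableSet[coordSigma X A] t →
      P⟦t | coordSigma X (B ∪ C)⟧ =ᵐ[P] P⟦t | coordSigma X C⟧ := by
  rw [condIndepGiven_iff_condIndep, condIndep_iff_condExp_sup_eq _ (coordSigma_le A)
    (coordSigma_le B), coordSigma_union]

theorem CondIndepGiven.symm {A B C : Set V} (h : CondIndepGiven P A B C) :
    CondIndepGiven P B A C :=
  condIndepGiven_iff_condIndep.2 (condIndepGiven_iff_condIndep.1 h).symm

theorem CondIndepGiven.mono {A A' B B' C : Set V} (h : CondIndepGiven P A B C) (hA : A' ⊆ A)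
    (hB : B' ⊆ B) : CondIndepGiven P A' B' C := by
  rw [condIndepGiven_iff_condIndep] at h ⊢
  exact condIndep_of_condIndep_of_le_left
    (condIndep_of_condIndep_of_le_right h (coordSigma_mono hB)) (coordSigma_mono hA)

/-- Weak union for sets of variables: some of the variables independent of `X_A` may be moved into
the conditioning. -/
theorem CondIndepGiven.weak_union {A B C D : Set V} (h : CondIndepGiven P A (B ∪ D) C) :
    CondIndepGiven P A B (D ∪ C) := by
  rw [condIndepGiven_iff_condIndep, coordSigma_union] at h
  rw [condIndepGiven_iff_condIndep]
  have := h.weak_union (coordSigma_le A) (coordSigma_le B) (coordSigma_le D)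
  convert this using 1
  exact coordSigma_union D C

theorem condIndepGiven_empty_right (A C : Set V) : CondIndepGiven P A ∅ C :=
  condIndepGiven_iff_condExp_eq.2 fun t _ => by rw [Set.empty_union]

end condIndepGiven

section MarkovProperties

variable {V : Type*} [Fintype V] {X : V → Type*} [∀ v, MeasurableSpace (X v)]
  [∀ v, StandardBorelSpace (X v)] {P : Measure (∀ v, X v)} [IsProbabilityMeasure P]

/-- The intersection property of strictly positive distributions, for conditioning on all the
remaining variables. The conditional probability of an `A`-event given `Aᶜ` is a function of the
coordinates outside `A ∪ B`, and also of those outside `A ∪ D`; by positivity it is a function of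
the coordinates outside `A ∪ (B ∪ D)`. -/
theorem CondIndepGiven.union_right (hP : IsStrictlyPositive P) {A B D : Set V}
    (hAB : Disjoint A B) (hAD : Disjoint A D) (hB : CondIndepGiven P A B (A ∪ B)ᶜ)
    (hD : CondIndepGiven P A D (A ∪ D)ᶜ) : CondIndepGiven P A (B ∪ D) (A ∪ (B ∪ D))ᶜ := by
  have key {S : Set V} (hAS : Disjoint A S) : S ∪ (A ∪ S)ᶜ = Aᶜ := by
    rw [Set.disjoint_left] at hAS
    ext v
    have := @hAS v
    simp only [Set.mem_union, Set.mem_compl_iff]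
    tauto
  rw [condIndepGiven_iff_condExp_eq, key hAB] at hB
  rw [condIndepGiven_iff_condExp_eq, key hAD] at hD
  rw [condIndepGiven_iff_condExp_eq, key (hAB.union_right hAD)]
  intro t ht
  obtain ⟨h, hmeas, hae⟩ := hP.exists_measurable_inter
    (stronglyMeasurable_condExp (m := coordSigma X (A ∪ B)ᶜ)
      (f := t.indicator fun _ => (1 : ℝ)) (μ := P)).measurable
    (stronglyMeasurable_condExp (m := coordSigma X (A ∪ D)ᶜ)
      (f := t.indicator fun _ => (1 : ℝ)) (μ := P)).measurable
    ((hB t ht).symm.trans (hD t ht))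
  have hinter : (A ∪ B)ᶜ ∩ (A ∪ D)ᶜ = (A ∪ (B ∪ D))ᶜ := by
    rw [← Set.compl_union, ← Set.union_union_distrib_left]
  rw [hinter] at hmeas
  have hA : P⟦t | coordSigma X Aᶜ⟧ =ᵐ[P] h := (hB t ht).trans hae
  have hsub : (A ∪ (B ∪ D))ᶜ ⊆ Aᶜ := Set.compl_subset_compl.2 Set.subset_union_left
  have hint : Integrable h P := integrable_condExp.congr hA
  calc P⟦t | coordSigma X Aᶜ⟧ =ᵐ[P] h := hA
    _ = P[h | coordSigma X (A ∪ (B ∪ D))ᶜ] :=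
      (condExp_of_stronglyMeasurable (coordSigma_le _) hmeas.stronglyMeasurable hint).symm
    _ =ᵐ[P] P[P⟦t | coordSigma X Aᶜ⟧ | coordSigma X (A ∪ (B ∪ D))ᶜ] := condExp_congr_ae hA.symm
    _ =ᵐ[P] P⟦t | coordSigma X (A ∪ (B ∪ D))ᶜ⟧ :=
      condExp_condExp_of_le (coordSigma_mono hsub) (coordSigma_le _)

theorem CondIndepGiven.of_forall_singleton_right (hP : IsStrictlyPositive P) {A : Set V} (B : Set V)
    (hAB : Disjoint A B) (h : ∀ b ∈ B, CondIndepGiven P A {b} (A ∪ {b})ᶜ) :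
    CondIndepGiven P A B (A ∪ B)ᶜ := by
  induction B, B.toFinite using Set.Finite.induction_on with
  | empty => exact condIndepGiven_empty_right _ _
  | @insert b B _ _ ih =>
    rw [Set.insert_eq] at hAB h ⊢
    rw [Set.disjoint_union_right] at hAB
    exact union_right hP hAB.1 hAB.2 (h b (Or.inl rfl)) (ih hAB.2 fun c hc => h c (Or.inr hc))

variable {G : SimpleGraph V}

/-- For strictly positive distributions, the pairwise Markov property extends from pairs of vertices
to pairs of sets of vertices. -/
theorem PairwiseMarkov.condIndepGiven_compl (hP : IsStrictlyPositive P) (h : PairwiseMarkov G P)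
    {A B : Set V} (hAB : Disjoint A B) (hadj : ∀ a ∈ A, ∀ b ∈ B, ¬ G.Adj a b) :
    CondIndepGiven P A B (A ∪ B)ᶜ := by
  refine .of_forall_singleton_right hP B hAB fun b hb => ?_
  have hbA : b ∉ A := fun hbA => Set.disjoint_left.1 hAB hbA hb
  rw [Set.union_comm]
  refine (CondIndepGiven.of_forall_singleton_right hP A
    (Set.disjoint_singleton_left.2 hbA) fun a ha => ?_).symm
  rw [Set.union_comm]
  exact (h a b (fun hab => hbA (hab ▸ ha)) (hadj a ha b hb)).symm

/-! ### Implications between the Markov properties -/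

/-- Enlarge `A` to the set of vertices reachable from it without meeting `C`, and `B` to everything
else outside `C`: no edge joins the two enlarged sets, and they exhaust the complement of `C`. -/
theorem PairwiseMarkov.globalMarkov (hP : IsStrictlyPositive P) (h : PairwiseMarkov G P) :
    GlobalMarkov G P := by
  intro A B C _ hAC hBC hsep
  rw [Set.disjoint_left] at hAC hBC
  let A' : Set V := {v | ∃ a ∈ A, ∃ w : G.Walk a v, ∀ c ∈ C, c ∉ w.support}
  let B' : Set V := (A' ∪ C)ᶜ
  have hA'C : Disjoint A' C := by
    rw [Set.disjoint_left]
    rintro v ⟨a, -, w, hw⟩ hv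
    exact hw v hv w.end_mem_support
  have hA'B' : Disjoint A' B' := Set.disjoint_left.2 fun v hv hv' => hv' (Or.inl hv)
  have hcompl : (A' ∪ B')ᶜ = C := by
    rw [Set.disjoint_left] at hA'C
    ext v
    have := @hA'C v
    simp only [B', Set.mem_compl_iff, Set.mem_union]
    tauto
  have hadj : ∀ a ∈ A', ∀ b ∈ B', ¬ G.Adj a b := by
    rintro v ⟨a, ha, w, hw⟩ b hb hvb
    refine hb (Or.inl ⟨a, ha, w.concat hvb, fun c hc => ?_⟩)
    rw [SimpleGraph.Walk.support_concat, List.mem_append,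
      List.mem_singleton, not_or]
    exact ⟨hw c hc, fun hcb => hb (Or.inr (hcb ▸ hc))⟩
  have hI := h.condIndepGiven_compl hP hA'B' hadj
  rw [hcompl] at hI
  refine hI.mono (fun a ha => ⟨a, ha, .nil, fun c hc hca => ?_⟩) fun b hb => ?_
  · rw [SimpleGraph.Walk.support_nil, List.mem_singleton] at hca
    exact hAC ha (hca ▸ hc)
  · rintro (⟨a, ha, w, hw⟩ | hbC)
    · obtain ⟨c, hc, hcw⟩ := hsep a ha b hb w
      exact hw c hc hcw
    · exact hBC hb hbC

theorem GlobalMarkov.localMarkov (h : GlobalMarkov G P) : LocalMarkov G P := by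
  intro v
  refine h _ _ _ ?_ ?_ ?_ ?_
  · exact Set.disjoint_singleton_left.2 fun hv => hv (Or.inl rfl)
  · exact Set.disjoint_singleton_left.2 (by simp)
  · exact Set.disjoint_left.2 fun u hu hu' => hu (Or.inr hu')
  · rintro a rfl b hb w
    cases w with
    | nil => exact absurd (Or.inl rfl) hb
    | @cons _ u _ hau w => exact ⟨u, hau, by simp⟩

theorem LocalMarkov.pairwiseMarkov (h : LocalMarkov G P) : PairwiseMarkov G P := by
  intro v w hvw hadj
  have hl := h v
  have h1 : ({v} ∪ G.neighborSet v)ᶜ = {w} ∪ ({v, w} ∪ G.neighborSet v)ᶜ := by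
    ext u
    by_cases huw : u = w
    · subst huw
      simp [hvw.symm, hadj]
    · simp [huw]
  have h2 : ({v, w} ∪ G.neighborSet v)ᶜ ∪ G.neighborSet v = {v, w}ᶜ := by
    ext u
    by_cases hu : G.Adj v u
    · have hv : u ≠ v := hu.ne'
      have hw : u ≠ w := fun huw => hadj (huw ▸ hu)
      simp [hu, hv, hw]
    · simp [hu]
  rw [h1] at hl
  have := hl.weak_union
  rwa [h2] at this

/-- Mutual conditional independence of the variables in `S` amounts to the conditional independence
of each of them from all the others. -/
theorem mutualCondIndepGiven_iff {S C : Set V} :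
    MutualCondIndepGiven P S C ↔ ∀ v ∈ S, CondIndepGiven P {v} (S \ {v}) C := by
  have hmeas (v : S) : Measurable fun x : ∀ v, X v => x (v : V) := measurable_pi_apply _
  have hsub (s : Set S) : coordSigma X ((↑) '' s) = ⨆ i ∈ s,
      MeasurableSpace.comap (fun x : ∀ v, X v => x (i : V)) inferInstance := by
    rw [coordSigma_eq_iSup, iSup_image]
  constructor
  · intro h v hv
    have h' := condIndep_iSup_of_disjoint (fun i => (hmeas i).comap_le)
      ((iCondIndepFun_iff_iCondIndep _ _ _ _ _).1 h)
      (S := {⟨v, hv⟩}) (T := {⟨v, hv⟩}ᶜ) disjoint_compl_right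
    rw [← hsub, ← hsub] at h'
    refine (condIndepGiven_iff_condIndep.2 h').mono (by simp) ?_
    rintro u ⟨hu, huv⟩
    exact ⟨⟨u, hu⟩, by simpa using huv, rfl⟩
  · intro h
    rw [MutualCondIndepGiven, iCondIndepFun_iff _ _ _ _ hmeas]
    classical
    intro s g hg
    induction s using Finset.induction_on with
    | empty =>
      simp only [Finset.notMem_empty, Set.iInter_of_empty, Set.iInter_univ, Set.indicator_univ,
        Finset.prod_empty, condExp_const (coordSigma_le C)]
      exact .rfl
    | insert i s hi ih =>
      rw [Finset.set_biInter_insert, Finset.prod_insert hi]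
      have hgs : MeasurableSet[coordSigma X (S \ {(i : V)})] (⋂ j ∈ s, g j) := by
        refine MeasurableSet.biInter s.countable_toSet fun j hj => ?_
        have hle : coordSigma X {(j : V)} ≤ coordSigma X (S \ {(i : V)}) :=
          coordSigma_mono (Set.singleton_subset_iff.2 ⟨j.2, fun hji => ?_⟩)
        · rw [coordSigma_singleton] at hle
          exact hle _ (hg j (Finset.mem_insert_of_mem hj))
        · exact hi (Subtype.ext hji ▸ hj)
      have hgi := hg i (Finset.mem_insert_self _ _)
      have hi' := condIndepGiven_iff_condIndep.1 (h i i.2)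
      rw [condIndep_iff _ _ _ _ (coordSigma_le _) (coordSigma_le _)] at hi'
      refine (hi' (g i) (⋂ j ∈ s, g j) (by rwa [coordSigma_singleton]) hgs).trans ?_
      exact Filter.EventuallyEq.rfl.mul (ih fun j hj => hg j (Finset.mem_insert_of_mem hj))

theorem MCIP.pairwiseMarkov (h : MCIP G P) : PairwiseMarkov G P := by
  intro v w hvw hadj
  have hind : G.IsIndepSet {v, w} := by
    rw [SimpleGraph.isIndepSet_iff, Set.pairwise_pair]
    exact fun _ => ⟨hadj, fun hwv => hadj hwv.symm⟩
  obtain ⟨S, hsub, hS⟩ := Finite.exists_le_maximal hind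
  have hv : v ∈ S := hsub (Or.inl rfl)
  have hw : w ∈ S := hsub (Or.inr rfl)
  have hm := mutualCondIndepGiven_iff.1 (h S hS) v hv
  have h1 : S \ {v} = {w} ∪ S \ {v, w} := by
    ext u
    by_cases huw : u = w
    · subst huw
      simp [hvw.symm, hw]
    · simp [huw]
  have h2 : S \ {v, w} ∪ Sᶜ = {v, w}ᶜ := by
    ext u
    by_cases hu : u ∈ S
    · simp [hu]
    · have huv : u ≠ v := fun e => hu (e ▸ hv)
      have huw : u ≠ w := fun e => hu (e ▸ hw)
      simp [hu, huv, huw]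
  rw [h1] at hm
  have := hm.weak_union
  rwa [h2] at this

theorem PairwiseMarkov.mcip (hP : IsStrictlyPositive P) (h : PairwiseMarkov G P) : MCIP G P := by
  intro S hS
  refine mutualCondIndepGiven_iff.2 fun v hv => ?_
  have := h.condIndepGiven_compl hP (A := {v}) (B := S \ {v}) Set.disjoint_sdiff_right ?_
  · rwa [Set.union_sdiff_cancel (Set.singleton_subset_iff.2 hv)] at this
  · rintro a rfl b ⟨hb, hba⟩
    exact hS.prop hv hb (Ne.symm hba)

end MarkovProperties

end MarkovNetwork

theorem theorem17 {V : Type*} [Fintype V] {X : V → Type*}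
    [∀ v, MeasurableSpace (X v)] [∀ v, StandardBorelSpace (X v)]
    (G : SimpleGraph V)
    (P : Measure (∀ v, X v)) [IsProbabilityMeasure P]
    (hP : MarkovNetwork.IsStrictlyPositive P) :
    (MarkovNetwork.MCIP G P →
      MarkovNetwork.PairwiseMarkov G P ∧ MarkovNetwork.LocalMarkov G P ∧
        MarkovNetwork.GlobalMarkov G P) ∧
    (MarkovNetwork.MCIP G P ↔ MarkovNetwork.PairwiseMarkov G P) ∧
    (MarkovNetwork.PairwiseMarkov G P ↔ MarkovNetwork.LocalMarkov G P) ∧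
    (MarkovNetwork.LocalMarkov G P ↔ MarkovNetwork.GlobalMarkov G P) := by
  have hPG (h : MarkovNetwork.PairwiseMarkov G P) := h.globalMarkov hP
  have hGL (h : MarkovNetwork.GlobalMarkov G P) := h.localMarkov
  have hLP (h : MarkovNetwork.LocalMarkov G P) := h.pairwiseMarkov
  have hMP (h : MarkovNetwork.MCIP G P) := h.pairwiseMarkov
  have hPM (h : MarkovNetwork.PairwiseMarkov G P) := h.mcip hP
  exact ⟨fun h => ⟨hMP h, hGL (hPG (hMP h)), hPG (hMP h)⟩, ⟨hMP, hPM⟩,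
    ⟨fun h => hGL (hPG h), hLP⟩, ⟨fun h => hPG (hLP h), hGL⟩⟩
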